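/- **Setting.** Along an index $n\to\infty$ let $T=T_n\to\infty$ (size of the training sample), $J=J_n$ (dimension) and $B=B_n$ (size of the validation sample) be natural numbers. For each $n$ we observe $J$-dimensional random vectors $X_1,\dots,X_{T+B}$ (a triangular array) with finite fourth moments, $\mathsf E X_t=0$ and $\mathsf E X_tX_t^\top=\Sigma=(\sigma_{ij})$ independent of $t$. For a set $I$ of consecutive times the sample covariance matrix is $|I|^{-1}\sum_{t\in I}(X_t-\bar X_I)(X_t-\bar X_I)^\top$ with $\bar X_I=|I|^{-1}\sum_{t\in I}X_t$. Let $\hat\Sigma$ be the one of $X_1,\dots,X_T$, and $\hat\Sigma_B$ the one of the following segment $X_{T+1},\dots,X_{T+B}$. Let $T_s(A)=[a_{ij}\mathbf 1(|a_{ij}|\ge s)]$ be hard thresholding and $\|\cdot\|_F$ the Frobenius norm. Assume, for constants $0\le q<1$, $M$, $\sigma^2$, $\delta'>0$ and a function $c_0(J)$: * *(sparsity)* $\sigma_{ii}\le M$ and $\sum_{j}|\sigma_{ij}|^q\le c_0(J)$ for all $i$ (with $0^0=0$); * *(moments)* $m^{-1}\mathsf E\{\sum_{t=k}^{k+m}(X_{ti}X_{tj}-\sigma_{ij})\}^2\le\sigma^2$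 and $m^{-1}\mathsf E(\sum_{t=k}^{k+m}X_{ti})^2\le\sigma^2$ for all $i,j$, all $m\ge1$ and all $k$ with $k,\dots,k+m$ observed times; * *(boundedness)* with probability tending to one, $|X_{ti}X_{tj}|\le M$ for all $t,i,j$; * *(mixing)* for all $i,j$ the sequence $(X_{ti}X_{tj})_t$ is $\beta$-mixing, with coefficient at some lag $\ell_n\ge1$, $\ell_n=o(T)$ (for example $\ell_n=1$), of order $\mathcal O\{(J^{2+\delta'}\sqrt{T\log J})^{-1}\}$, uniformly in $i,j$. Here the coefficient at lag $\ell$ is the supremum over $t$ of $\beta(\mathcal U,\mathcal V)=\mathsf E\,\mathrm{ess\,sup}_{V\in\mathcal V}|\mathsf P(V\mid\mathcal U)-\mathsf P(V)|$ for $\mathcal U$ generated by the sequence up to time $t$ and $\mathcal V$ by the sequence from time $t+\ell$ on; * $\log J/T\to0$, and $B=T\,\varepsilon(T,J)$ with $\varepsilon(T,J)>0$ bounded above. **Thresholds.** Let $G=G_n$ be a finite set of $P=P_n$ candidate thresholds with $$\log P=o\{T^{q/2}c_0(J)J^{-1}(\log J)^{1-q/2}\varepsilon(T,J)\}.$$ Let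 $\hat s\in G$ be any minimizer over $G$ of the empirical loss $\|T_s(\hat\Sigma)-\hat\Sigma_B\|_F^2$, and $s^o\in G$ any minimizer over $G$ of the oracle loss $\mathsf E\|T_s(\hat\Sigma)-\hat\Sigma_B\|_F^2$. Assume that the rate is exact for the oracle, in the sense that $$J^{-1}\|T_{s^o}(\hat\Sigma)-\Sigma\|_F^2=\Omega_P\{c_0(J)(\log J/T)^{1-q/2}\},$$ where $Y_n=\Omega_P(r_n)$ means: for every $\eta>0$ there is $c>0$ with $\mathsf P(Y_n<c\,r_n)\le\eta$ for all large $n$. **Conclusion.** $\|T_{\hat s}(\hat\Sigma)-\Sigma\|_F=\|T_{s^o}(\hat\Sigma)-\Sigma\|_F\{1+o_P(1)\}$, that is, for every $\eta>0$, $$\mathsf P\Big(\big|\|T_{\hat s}(\hat\Sigma)-\Sigma\|_F-\|T_{s^o}(\hat\Sigma)-\Sigma\|_F\big|>\eta\,\|T_{s^o}(\hat\Sigma)-\Sigma\|_F\Big)\to0 .$$ -/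

import Mathlib

open MeasureTheory Filter Topology Asymptotics
open scoped ENNReal

attribute [local instance] Matrix.frobeniusNormedAddCommGroup

/-- Hard thresholding `T_s(A) = [a_ij 1(|a_ij| ≥ s)]`. -/
noncomputable def hardThreshold {J : ℕ} (s : ℝ) (A : Matrix (Fin J) (Fin J) ℝ) :
    Matrix (Fin J) (Fin J) ℝ :=
  fun i j => if s ≤ |A i j| then A i j else 0

/-- Sample mean of coordinate `i` over the time points in `I`. -/
noncomputable def sampleMean {Ω : Type*} {J : ℕ} (X : ℕ → Ω → Fin J → ℝ) (I : Finset ℕ)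
    (ω : Ω) (i : Fin J) : ℝ :=
  (I.card : ℝ)⁻¹ * ∑ t ∈ I, X t ω i

/-- Sample covariance matrix (centred at the sample mean) over the time points in `I`. -/
noncomputable def sampleCov {Ω : Type*} {J : ℕ} (X : ℕ → Ω → Fin J → ℝ) (I : Finset ℕ)
    (ω : Ω) : Matrix (Fin J) (Fin J) ℝ :=
  fun i j => (I.card : ℝ)⁻¹ *
    ∑ t ∈ I, (X t ω i - sampleMean X I ω i) * (X t ω j - sampleMean X I ω j)

/-- The class `U(q, c₀, M)`: `σ_ii ≤ M` and `∑_j |σ_ij|^q ≤ c₀` for every row `i`.  For `q = 0` the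
sum is the number of nonzero entries of the row (that is, `0^0 = 0`). -/
def SparseClass {J : ℕ} (q c₀ M : ℝ) (A : Matrix (Fin J) (Fin J) ℝ) : Prop :=
  ∀ i, A i i ≤ M ∧ (∑ j, if A i j = 0 then 0 else |A i j| ^ q) ≤ c₀

/-- The coefficient `β(𝒰, 𝒱) = E ess sup {|P(V | 𝒰) - P(V)| : V ∈ 𝒱}`.  The essential supremum of
the family is its least almost-everywhere upper bound, so its expectation is the infimum of the
expectations of the almost-everywhere upper bounds. -/
noncomputable def betaCoeff {Ω : Type*} [mΩ : MeasurableSpace Ω] (μ : Measure Ω)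
    (𝒰 𝒱 : MeasurableSpace Ω) : ℝ≥0∞ :=
  ⨅ (g : Ω → ℝ≥0∞) (_ : Measurable[mΩ] g)
    (_ : ∀ A : Set Ω, MeasurableSet[𝒱] A →
      ∀ᵐ ω ∂μ, ENNReal.ofReal |(μ[A.indicator (fun _ => (1 : ℝ)) | 𝒰]) ω - μ.real A| ≤ g ω),
    ∫⁻ ω, g ω ∂μ

/-- The β-mixing coefficient at lag `ℓ` of the finite sequence `V 0, …, V (N - 1)`: the supremum
over `t` of the coefficient between `σ(V s : s ≤ t)` and `σ(V s : t + ℓ ≤ s < N)`. -/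
noncomputable def betaMix {Ω : Type*} [MeasurableSpace Ω] (μ : Measure Ω)
    (V : ℕ → Ω → ℝ) (N ℓ : ℕ) : ℝ≥0∞ :=
  ⨆ (t : ℕ) (_ : t + ℓ < N),
    betaCoeff μ
      (⨆ (s : ℕ) (_ : s ≤ t), MeasurableSpace.comap (V s) inferInstance)
      (⨆ (s : ℕ) (_ : t + ℓ ≤ s ∧ s < N), MeasurableSpace.comap (V s) inferInstance)

/-- The non-asymptotic conditions on the observations `X 0, …, X (N - 1)` with covariance `S`. -/
structure MomentConditions {Ω : Type*} [MeasurableSpace Ω] (μ : Measure Ω) {J : ℕ}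
    (X : ℕ → Ω → Fin J → ℝ) (N : ℕ) (S : Matrix (Fin J) (Fin J) ℝ) (σsq : ℝ) : Prop where
  measurable : ∀ t < N, Measurable (X t)
  fourth_moment : ∀ t < N, ∀ i, MemLp (fun ω => X t ω i) 4 μ
  mean_zero : ∀ t < N, ∀ i, ∫ ω, X t ω i ∂μ = 0
  second_moment : ∀ t < N, ∀ i j, ∫ ω, X t ω i * X t ω j ∂μ = S i j
  /-- partial sums of the centred products have variance of linear order -/
  product_sums : ∀ i j, ∀ n m : ℕ, 1 ≤ m → n + m < N →
    (m : ℝ)⁻¹ * ∫ ω, (∑ t ∈ Finset.Icc n (n + m), (X t ω i * X t ω j - S i j)) ^ 2 ∂μ ≤ σsq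
  /-- the same for the coordinates, which controls the centring at the sample mean -/
  coordinate_sums : ∀ i, ∀ n m : ℕ, 1 ≤ m → n + m < N →
    (m : ℝ)⁻¹ * ∫ ω, (∑ t ∈ Finset.Icc n (n + m), X t ω i) ^ 2 ∂μ ≤ σsq

/-- Cross-validation loss at threshold `s`: training on the first `T` observations, validation on
the `B` observations that follow them. -/
noncomputable def cvLoss {Ω : Type*} {J : ℕ} (X : ℕ → Ω → Fin J → ℝ) (T B : ℕ) (s : ℝ) (ω : Ω) :
    ℝ :=
  ‖hardThreshold s (sampleCov X (Finset.range T) ω) - sampleCov X (Finset.Ico T (T + B)) ω‖ ^ 2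

/-- Estimation error `‖T_s(Σ̂) - S‖_F`, with `Σ̂` computed from the first `T` observations. -/
noncomputable def estError {Ω : Type*} {J : ℕ} (X : ℕ → Ω → Fin J → ℝ) (T : ℕ)
    (S : Matrix (Fin J) (Fin J) ℝ) (s : ℝ) (ω : Ω) : ℝ :=
  ‖hardThreshold s (sampleCov X (Finset.range T) ω) - S‖

/-- `s` is a minimizer of `L` over the finite set `G` of candidates. -/
def IsArgmin (L : ℝ → ℝ) (G : Finset ℝ) (s : ℝ) : Prop :=
  s ∈ G ∧ ∀ s' ∈ G, L s ≤ L s'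

/-- `Y_n = Ω_P(r_n)` (stochastic lower bound): for every `η > 0` there is `c > 0` such that
`Y_n ≥ c r_n` with probability at least `1 - η` for all large `n`. -/
def IsOmegaP {Ω : ℕ → Type*} [∀ n, MeasurableSpace (Ω n)] (μ : ∀ n, Measure (Ω n))
    (Y : ∀ n, Ω n → ℝ) (r : ℕ → ℝ) : Prop :=
  ∀ η : ℝ, 0 < η → ∃ c : ℝ, 0 < c ∧
    ∀ᶠ n in atTop, μ n {ω | Y n ω < c * r n} ≤ ENNReal.ofReal η

/-- `Y_n = Z_n (1 + o_P(1))`. -/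
def EqOneAddLittleOP {Ω : ℕ → Type*} [∀ n, MeasurableSpace (Ω n)] (μ : ∀ n, Measure (Ω n))
    (Y Z : ∀ n, Ω n → ℝ) : Prop :=
  ∀ η : ℝ, 0 < η →
    Tendsto (fun n => μ n {ω | η * |Z n ω| < |Y n ω - Z n ω|}) atTop (𝓝 0)

/-! ### Deterministic inequalities for hard thresholding in the Frobenius norm -/

section Frobenius

variable {J : ℕ}

/-! A single candidate leaves nothing to choose. With at least two, `log P ≥ log 2`, and the growth
condition already makes `J² / B` of smaller order than `J c₀ (log J / T)^(1 - q/2)`, the exact order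
of the squared oracle error (`sq_div_le_rate`). Since `ε` is bounded, `J² / T` is negligible as
well. It thus suffices to bound the difference of the two errors at the scale of the sampling errors
of `Σ̂` and `Σ̂_B`, which needs second moments only and no union bound over candidates.

Deterministically, the difference is at most those sampling errors plus `‖T_a(Σ̂) - T_r(Σ̂)‖`, with
`r` the oracle and `a` the least candidate (`abs_norm_hardThreshold_sub_le`). The square of this
spread is at most twice the loss at `r` minus twice the loss at `a`, up to sampling errors
(`norm_hardThreshold_sub_sq_le`). By optimality of `r` the loss difference has nonpositive
expectation, and Markov's inequality concludes. -/

lemma frobenius_norm_sq (A : Matrix (Fin J) (Fin J) ℝ) : ‖A‖ ^ 2 = ∑ i, ∑ j, A i j ^ 2 := by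
  rw [Matrix.frobenius_norm_def, ← Real.sqrt_eq_rpow, Real.sq_sqrt (by positivity)]
  simp

lemma frobenius_norm_le_of_sq_le {A B : Matrix (Fin J) (Fin J) ℝ}
    (h : ∀ i j, A i j ^ 2 ≤ B i j ^ 2) : ‖A‖ ≤ ‖B‖ := by
  refine le_of_sq_le_sq ?_ (norm_nonneg _)
  rw [frobenius_norm_sq, frobenius_norm_sq]
  exact Finset.sum_le_sum fun i _ => Finset.sum_le_sum fun j _ => h i j

lemma norm_hardThreshold_sub_self_mono {s s' : ℝ} (h : s ≤ s') (A : Matrix (Fin J) (Fin J) ℝ) :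
    ‖hardThreshold s A - A‖ ≤ ‖hardThreshold s' A - A‖ := by
  refine frobenius_norm_le_of_sq_le fun i j => ?_
  simp only [hardThreshold, Matrix.sub_apply]
  split_ifs <;> first | positivity | nlinarith

lemma norm_hardThreshold_sub_antitone {s s' r : ℝ} (h : s ≤ s') (h' : s' ≤ r)
    (A : Matrix (Fin J) (Fin J) ℝ) :
    ‖hardThreshold s' A - hardThreshold r A‖ ≤ ‖hardThreshold s A - hardThreshold r A‖ := by
  refine frobenius_norm_le_of_sq_le fun i j => ?_
  simp only [hardThreshold, Matrix.sub_apply]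
  split_ifs <;> first | linarith | (simp; try positivity)

/-- Only entries kept at `s` and killed at `r` matter on the left; for them the claim is `x² ≤ 2b² +
2(x - b)²`. -/
lemma norm_hardThreshold_sub_sq_le {s r : ℝ} (h : s ≤ r) (A B : Matrix (Fin J) (Fin J) ℝ) :
    ‖hardThreshold s A - hardThreshold r A‖ ^ 2 ≤
      2 * ‖hardThreshold r A - B‖ ^ 2 - 2 * ‖hardThreshold s A - B‖ ^ 2 + 4 * ‖A - B‖ ^ 2 := by
  simp only [frobenius_norm_sq, Finset.mul_sum, ← Finset.sum_sub_distrib, ← Finset.sum_add_distrib]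
  gcongr with i _ j _
  simp only [hardThreshold, Matrix.sub_apply]
  split_ifs
  · nlinarith [sq_nonneg (A i j - B i j)]
  · nlinarith [sq_nonneg (A i j - 2 * (A i j - B i j))]
  · linarith
  · nlinarith [sq_nonneg (A i j - B i j)]

/-- Replacing the minimizer of an empirical loss by any competitor changes the estimation error by
at most the errors of the two empirical covariance matrices and the spread of the estimator below
the competitor. -/
lemma abs_norm_hardThreshold_sub_le {A B S : Matrix (Fin J) (Fin J) ℝ} {a s r : ℝ}
    (has : a ≤ s)
    (hmin : ‖hardThreshold s A - B‖ ^ 2 ≤ ‖hardThreshold r A - B‖ ^ 2) :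
    |‖hardThreshold s A - S‖ - ‖hardThreshold r A - S‖| ≤
      2 * ‖B - S‖ + 2 * ‖A - S‖ + ‖hardThreshold a A - hardThreshold r A‖ := by
  have hmin' := le_of_sq_le_sq hmin (norm_nonneg _)
  have hB := norm_nonneg (B - S)
  have hA := norm_nonneg (A - S)
  have hD := norm_nonneg (hardThreshold a A - hardThreshold r A)
  have h1 := norm_sub_le_norm_sub_add_norm_sub (hardThreshold s A) B S
  have h2 := norm_sub_le_norm_sub_add_norm_sub (hardThreshold r A) S B
  rw [norm_sub_rev S B] at h2
  rw [abs_le]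
  refine ⟨?_, by linarith⟩
  -- Below the competitor, monotonicity in the threshold gives the spread term. Above it, `T_s(A)`
  -- is further from `A` than `T_r(A)` is, so two passages through `A` suffice.
  rcases le_total s r with h | h
  · have h3 := norm_sub_le_norm_sub_add_norm_sub (hardThreshold r A) (hardThreshold s A) S
    rw [norm_sub_rev (hardThreshold r A) (hardThreshold s A)] at h3
    have h4 := norm_hardThreshold_sub_antitone has h A
    linarith
  · have h3 := norm_sub_le_norm_sub_add_norm_sub (hardThreshold r A) A S
    have h4 := norm_sub_le_norm_sub_add_norm_sub (hardThreshold s A) S A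
    rw [norm_sub_rev S A] at h4
    have h5 := norm_hardThreshold_sub_self_mono h A
    linarith

end Frobenius

/-! ### Sample covariance: algebra and second moments -/

lemma sampleCov_eq {Ω : Type*} {J : ℕ} (X : ℕ → Ω → Fin J → ℝ) {I : Finset ℕ} (hI : I.Nonempty) (ω : Ω)
    (i j : Fin J) (c : ℝ) :
    sampleCov X I ω i j = c + (I.card : ℝ)⁻¹ * ∑ t ∈ I, (X t ω i * X t ω j - c) -
      sampleMean X I ω i * sampleMean X I ω j := by
  have hc : (I.card : ℝ) ≠ 0 := by exact_mod_cast hI.card_pos.ne'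
  simp only [sampleCov, sampleMean, sub_mul, mul_sub, Finset.sum_sub_distrib, ← Finset.sum_mul,
    ← Finset.mul_sum, Finset.sum_const, nsmul_eq_mul]
  field_simp
  ring

/-- Nonnegativity of the sample variance. It trades a squared mean for an average of products, so
that products of means can be squared without moments beyond the fourth. -/
lemma sampleMean_sq_le {Ω : Type*} {J : ℕ} (X : ℕ → Ω → Fin J → ℝ) {I : Finset ℕ} (hI : I.Nonempty) (ω : Ω)
    (i : Fin J) (c : ℝ) :
    sampleMean X I ω i ^ 2 ≤ c + (I.card : ℝ)⁻¹ * ∑ t ∈ I, (X t ω i * X t ω i - c) := by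
  have h := sampleCov_eq X hI ω i i c
  have h0 : 0 ≤ sampleCov X I ω i i :=
    mul_nonneg (by positivity) (Finset.sum_nonneg fun t _ => mul_self_nonneg _)
  rw [h] at h0
  linarith [sq (sampleMean X I ω i)]

section SecondMoments

instance holderTriple_four_four_two : ENNReal.HolderTriple 4 4 2 := ⟨by
  rw [← two_mul, show (4 : ℝ≥0∞) = 2 * 2 by norm_num,
    ENNReal.mul_inv (by simp) (by simp), ← mul_assoc, ENNReal.mul_inv_cancel (by simp) (by simp),
    one_mul]⟩

variable {Ω : Type*} [MeasurableSpace Ω] {μ : Measure Ω}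

lemma integral_sq_sum_Ico_le {Y : ℕ → Ω → ℝ} {N : ℕ} {v : ℝ}
    (hY : ∀ t < N, MemLp (Y t) 2 μ)
    (hv : ∀ n m : ℕ, 1 ≤ m → n + m < N →
      (m : ℝ)⁻¹ * ∫ ω, (∑ t ∈ Finset.Icc n (n + m), Y t ω) ^ 2 ∂μ ≤ v)
    {a b : ℕ} (hb : 1 ≤ b) (hab : 2 ≤ a ∨ 2 ≤ b) (hN : a + b ≤ N) :
    ∫ ω, (∑ t ∈ Finset.Ico a (a + b), Y t ω) ^ 2 ∂μ ≤ 6 * v * b := by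
  have hv' : ∀ n m : ℕ, 1 ≤ m → n + m < N →
      ∫ ω, (∑ t ∈ Finset.Icc n (n + m), Y t ω) ^ 2 ∂μ ≤ m * v := fun n m hm hnm =>
    (inv_mul_le_iff₀ (by exact_mod_cast hm)).1 (hv n m hm hnm)
  have hv0 : 0 ≤ v := by
    refine le_trans ?_ (hv 0 1 le_rfl (by omega))
    exact mul_nonneg (by positivity) (integral_nonneg fun ω => sq_nonneg _)
  rcases Nat.lt_or_ge b 2 with h | h
  · obtain rfl : b = 1 := by omega
    -- The moment condition covers only windows of `m + 1 ≥ 2` terms. A single term is the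
    -- difference of windows of lengths 3 and 2, whence `2 * 2v + 2 * v = 6v`.
    obtain ⟨c, rfl⟩ : ∃ c, a = c + 2 := ⟨a - 2, by omega⟩
    have hL : ∀ m, c + m < N → MemLp (fun ω => ∑ t ∈ Finset.Icc c (c + m), Y t ω) 2 μ :=
      fun m hm => memLp_finsetSum _ fun t ht => hY t (by rw [Finset.mem_Icc] at ht; omega)
    have hI1 := (hL 1 (by omega)).integrable_sq
    have hI2 := (hL 2 (by omega)).integrable_sq
    calc ∫ ω, (∑ t ∈ Finset.Ico (c + 2) (c + 2 + 1), Y t ω) ^ 2 ∂μ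
        ≤ ∫ ω, (2 * (∑ t ∈ Finset.Icc c (c + 2), Y t ω) ^ 2 +
            2 * (∑ t ∈ Finset.Icc c (c + 1), Y t ω) ^ 2) ∂μ := by
          refine integral_mono_of_nonneg (ae_of_all _ fun ω => sq_nonneg _)
            ((hI2.const_mul 2).add (hI1.const_mul 2)) (ae_of_all _ fun ω => ?_)
          have hs : ∑ t ∈ Finset.Icc c (c + 2), Y t ω =
              ∑ t ∈ Finset.Icc c (c + 1), Y t ω + Y (c + 2) ω :=
            Finset.sum_Icc_succ_top (by omega) _
          simp only [Nat.Ico_succ_singleton, Finset.sum_singleton, hs]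
          nlinarith [sq_nonneg (2 * ∑ t ∈ Finset.Icc c (c + 1), Y t ω + Y (c + 2) ω)]
      _ = 2 * ∫ ω, (∑ t ∈ Finset.Icc c (c + 2), Y t ω) ^ 2 ∂μ +
            2 * ∫ ω, (∑ t ∈ Finset.Icc c (c + 1), Y t ω) ^ 2 ∂μ := by
          rw [integral_add (hI2.const_mul 2) (hI1.const_mul 2), integral_const_mul,
            integral_const_mul]
      _ ≤ 6 * v * (1 : ℕ) := by
          have h1 := hv' c 1 le_rfl (by omega)
          have h2 := hv' c 2 (by omega) (by omega)
          push_cast at h1 h2 ⊢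
          linarith
  · obtain ⟨m, rfl⟩ : ∃ m, b = m + 1 := ⟨b - 1, by omega⟩
    have heq : Finset.Ico a (a + (m + 1)) = Finset.Icc a (a + m) := by
      ext t; simp; omega
    rw [heq]
    refine (hv' a m (by omega) (by omega)).trans ?_
    push_cast
    nlinarith [mul_nonneg hv0 (Nat.cast_nonneg (α := ℝ) m)]

variable {J : ℕ} {X : ℕ → Ω → Fin J → ℝ} {N : ℕ} {S : Matrix (Fin J) (Fin J) ℝ} {v : ℝ}

lemma MomentConditions.memLp_mul (h : MomentConditions μ X N S v) {t : ℕ} (ht : t < N)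
    (i j : Fin J) : MemLp (fun ω => X t ω i * X t ω j) 2 μ := by
  exact (h.fourth_moment t ht j).mul (h.fourth_moment t ht i)

lemma MomentConditions.memLp_sampleMean (h : MomentConditions μ X N S v) {I : Finset ℕ}
    (hI : ∀ t ∈ I, t < N) (i : Fin J) : MemLp (fun ω => sampleMean X I ω i) 4 μ :=
  (memLp_finsetSum _ fun t ht => h.fourth_moment t (hI t ht) i).const_mul _

lemma MomentConditions.memLp_sampleCov (h : MomentConditions μ X N S v) {I : Finset ℕ}
    (hI : ∀ t ∈ I, t < N) (i j : Fin J) : MemLp (fun ω => sampleCov X I ω i j) 2 μ := by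
  have hd : ∀ t ∈ I, ∀ i, MemLp (fun ω => X t ω i - sampleMean X I ω i) 4 μ := fun t ht i =>
    (h.fourth_moment t (hI t ht) i).sub (h.memLp_sampleMean hI i)
  exact (memLp_finsetSum _ fun t ht => (hd t ht j).mul (hd t ht i)).const_mul _

variable [IsProbabilityMeasure μ]

lemma MomentConditions.integral_sampleCov_sub_sq_le (h : MomentConditions μ X N S v) {M : ℝ}
    (hM : ∀ i, S i i ≤ M) {a b : ℕ} (hb : 1 ≤ b) (hab : 2 ≤ a ∨ 2 ≤ b) (hN : a + b ≤ N)
    (i j : Fin J) :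
    ∫ ω, (sampleCov X (Finset.Ico a (a + b)) ω i j - S i j) ^ 2 ∂μ ≤
      12 * v * (2 * M + 3) / b := by
  have hb0 : (0 : ℝ) < b := by exact_mod_cast hb
  set I := Finset.Ico a (a + b) with hIdef
  have hI : ∀ t ∈ I, t < N := fun t ht => by rw [hIdef, Finset.mem_Ico] at ht; omega
  have hne : I.Nonempty := ⟨a, by rw [hIdef, Finset.mem_Ico]; omega⟩
  have hcard : (I.card : ℝ) = b := by simp [hIdef]
  have hS0 : ∀ i, 0 ≤ S i i := fun i => by
    rw [← h.second_moment 0 (by omega) i i]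
    exact integral_nonneg fun ω => mul_self_nonneg _
  have hM0 : 0 ≤ M := (hS0 i).trans (hM i)
  have hv0 : 0 ≤ v := by
    refine le_trans ?_ (h.coordinate_sums i 0 1 le_rfl (by omega))
    exact mul_nonneg (by positivity) (integral_nonneg fun ω => sq_nonneg _)
  let Y : Fin J → Fin J → Ω → ℝ := fun i j ω => (b : ℝ)⁻¹ * ∑ t ∈ I, (X t ω i * X t ω j - S i j)
  have hYL : ∀ i j, MemLp (Y i j) 2 μ := fun i j =>
    (memLp_finsetSum _ fun t ht => (h.memLp_mul (hI t ht) i j).sub (memLp_const _)).const_mul _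
  have scale : ∀ K : ℝ, K ≤ 6 * v * b → (b : ℝ)⁻¹ ^ 2 * K ≤ 6 * v / b := fun K hK => by
    calc (b : ℝ)⁻¹ ^ 2 * K ≤ (b : ℝ)⁻¹ ^ 2 * (6 * v * b) := by gcongr
      _ = 6 * v / b := by field_simp
  have hYE : ∀ i j, ∫ ω, Y i j ω ^ 2 ∂μ ≤ 6 * v / b := fun i j => by
    simp only [Y, mul_pow, integral_const_mul]
    exact scale _ (integral_sq_sum_Ico_le
      (fun t ht => (h.memLp_mul ht i j).sub (memLp_const _)) (h.product_sums i j) hb hab hN)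
  have h42 : (2 : ℝ≥0∞) ≤ 4 := by norm_num
  have hXL : MemLp (fun ω => sampleMean X I ω j) 2 μ :=
    (h.memLp_sampleMean hI j).mono_exponent h42
  have hXE : ∫ ω, sampleMean X I ω j ^ 2 ∂μ ≤ 6 * v / b := by
    simp only [sampleMean, mul_pow, integral_const_mul, hcard]
    exact scale _ (integral_sq_sum_Ico_le
      (fun t ht => (h.fourth_moment t ht j).mono_exponent h42) (h.coordinate_sums j) hb hab hN)
  have hpt : ∀ ω, (sampleCov X I ω i j - S i j) ^ 2 ≤
      2 * Y i j ω ^ 2 + (2 * M + 2) * sampleMean X I ω j ^ 2 + (2 * M + 1) * Y i i ω ^ 2 +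
        Y j j ω ^ 2 := fun ω => by
    have e : sampleCov X I ω i j = S i j + Y i j ω - sampleMean X I ω i * sampleMean X I ω j := by
      rw [sampleCov_eq X hne ω i j (S i j), hcard]
    have hi : sampleMean X I ω i ^ 2 ≤ S i i + Y i i ω := by
      simpa only [hcard] using sampleMean_sq_le X hne ω i (S i i)
    have hj : sampleMean X I ω j ^ 2 ≤ S j j + Y j j ω := by
      simpa only [hcard] using sampleMean_sq_le X hne ω j (S j j)
    have hMi := hM i
    have hMj := hM j
    rw [e]
    generalize sampleMean X I ω i = x at *
    generalize sampleMean X I ω j = z at *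
    generalize Y i i ω = y at *
    generalize Y j j ω = w at *
    generalize Y i j ω = u at *
    have h1 : (S i j + u - x * z - S i j) ^ 2 ≤ 2 * u ^ 2 + 2 * (x ^ 2 * z ^ 2) := by
      nlinarith [sq_nonneg (u + x * z)]
    have h2 : x ^ 2 * z ^ 2 ≤ (M + y) * z ^ 2 := by gcongr; linarith
    -- For `y ≤ 1` the first term suffices; for `y ≥ 1`, `z² ≤ M + w` reduces the quartic product to
    -- squares.
    have h3 : y * z ^ 2 ≤ z ^ 2 + M * y ^ 2 + (y ^ 2 + w ^ 2) / 2 := by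
      rcases le_total y 1 with hy | hy
      · nlinarith [mul_nonneg (sub_nonneg.2 hy) (sq_nonneg z), mul_nonneg hM0 (sq_nonneg y),
          sq_nonneg w, sq_nonneg y]
      · have h4 : y * z ^ 2 ≤ y * (M + w) := by gcongr; linarith
        nlinarith [mul_nonneg hM0 (mul_nonneg (sub_nonneg.2 hy) (zero_le_one.trans hy)),
          sq_nonneg (y - w), sq_nonneg z]
    nlinarith
  have i1 := (hYL i j).integrable_sq.const_mul 2
  have i2 := hXL.integrable_sq.const_mul (2 * M + 2)
  have i3 := (hYL i i).integrable_sq.const_mul (2 * M + 1)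
  have i4 := (hYL j j).integrable_sq
  calc _ ≤ ∫ ω, (2 * Y i j ω ^ 2 + (2 * M + 2) * sampleMean X I ω j ^ 2 +
        (2 * M + 1) * Y i i ω ^ 2 + Y j j ω ^ 2) ∂μ :=
        integral_mono_of_nonneg (ae_of_all _ fun ω => sq_nonneg _) (((i1.add i2).add i3).add i4)
          (ae_of_all _ hpt)
    _ = 2 * ∫ ω, Y i j ω ^ 2 ∂μ + (2 * M + 2) * ∫ ω, sampleMean X I ω j ^ 2 ∂μ +
        (2 * M + 1) * ∫ ω, Y i i ω ^ 2 ∂μ + ∫ ω, Y j j ω ^ 2 ∂μ := by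
        rw [integral_add (by exact (i1.add i2).add i3) i4, integral_add (by exact i1.add i2) i3,
          integral_add i1 i2]
        simp only [integral_const_mul]
    _ ≤ 2 * (6 * v / b) + (2 * M + 2) * (6 * v / b) + (2 * M + 1) * (6 * v / b) + 6 * v / b := by
        gcongr <;> exact hYE _ _
    _ = 12 * v * (2 * M + 3) / b := by ring

lemma MomentConditions.integral_norm_sampleCov_sub_sq_le (h : MomentConditions μ X N S v) {M : ℝ}
    (hM : ∀ i, S i i ≤ M) {a b : ℕ} (hb : 1 ≤ b) (hab : 2 ≤ a ∨ 2 ≤ b) (hN : a + b ≤ N) :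
    ∫ ω, ‖sampleCov X (Finset.Ico a (a + b)) ω - S‖ ^ 2 ∂μ ≤
      (J : ℝ) ^ 2 * (12 * v * (2 * M + 3) / b) := by
  have hL : ∀ i j, Integrable
      (fun ω => (sampleCov X (Finset.Ico a (a + b)) ω i j - S i j) ^ 2) μ := fun i j =>
    ((h.memLp_sampleCov (fun t ht => by rw [Finset.mem_Ico] at ht; omega) i j).sub
      (memLp_const _)).integrable_sq
  simp only [frobenius_norm_sq, Matrix.sub_apply]
  rw [integral_finsetSum _ fun i _ => integrable_finsetSum _ fun j _ => hL i j]
  simp_rw [integral_finsetSum Finset.univ fun j _ => hL _ j]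
  calc _ ≤ ∑ _i : Fin J, ∑ _j : Fin J, 12 * v * (2 * M + 3) / b :=
        Finset.sum_le_sum fun i _ => Finset.sum_le_sum fun j _ =>
          h.integral_sampleCov_sub_sq_le hM hb hab hN i j
    _ = _ := by simp; ring

end SecondMoments

/-! ### The selection gap and its expectation -/

/-- A bound for the difference between the estimation errors of the empirical and of the oracle
threshold `r`, where `a` is the least candidate. -/
noncomputable def selectionGap {Ω : Type*} {J : ℕ} (X : ℕ → Ω → Fin J → ℝ) (S : Matrix (Fin J) (Fin J) ℝ) (T B : ℕ)
    (a r : ℝ) (ω : Ω) : ℝ :=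
  2 * ‖sampleCov X (Finset.Ico T (T + B)) ω - S‖ + 2 * ‖sampleCov X (Finset.range T) ω - S‖ +
    ‖hardThreshold a (sampleCov X (Finset.range T) ω) -
      hardThreshold r (sampleCov X (Finset.range T) ω)‖

lemma selectionGap_sq_le {Ω : Type*} {J : ℕ} (X : ℕ → Ω → Fin J → ℝ) (S : Matrix (Fin J) (Fin J) ℝ) (T B : ℕ)
    {a r : ℝ} (har : a ≤ r) (ω : Ω) :
    selectionGap X S T B a r ω ^ 2 ≤
      36 * ‖sampleCov X (Finset.Ico T (T + B)) ω - S‖ ^ 2 +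
      36 * ‖sampleCov X (Finset.range T) ω - S‖ ^ 2 + 6 * cvLoss X T B r ω -
      6 * cvLoss X T B a ω := by
  have h1 := norm_hardThreshold_sub_sq_le har (sampleCov X (Finset.range T) ω)
    (sampleCov X (Finset.Ico T (T + B)) ω)
  have h2 := norm_sub_le_norm_sub_add_norm_sub (sampleCov X (Finset.range T) ω) S
    (sampleCov X (Finset.Ico T (T + B)) ω)
  rw [norm_sub_rev S] at h2
  simp only [selectionGap, cvLoss]
  generalize ‖hardThreshold a (sampleCov X (Finset.range T) ω) -
      hardThreshold r (sampleCov X (Finset.range T) ω)‖ = d at *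
  have h3 := pow_le_pow_left₀ (norm_nonneg _) h2 2
  generalize ‖sampleCov X (Finset.range T) ω - S‖ = x at *
  generalize ‖sampleCov X (Finset.Ico T (T + B)) ω - S‖ = y at *
  -- `(2y + 2x + d)² ≤ 12y² + 12x² + 3d²`, and `3d²` contributes `12(x + y)² ≤ 24(x² + y²)`; hence
  -- 36.
  nlinarith [sq_nonneg (x - y), sq_nonneg (2 * x - d), sq_nonneg (2 * y - d)]

section CrossValidation

variable {Ω : Type*} [MeasurableSpace Ω] {μ : Measure Ω} {J : ℕ}

lemma integrable_frobenius_norm_sq {A : Ω → Matrix (Fin J) (Fin J) ℝ}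
    (hA : ∀ i j, MemLp (fun ω => A ω i j) 2 μ) : Integrable (fun ω => ‖A ω‖ ^ 2) μ := by
  simp only [frobenius_norm_sq]
  exact integrable_finsetSum _ fun i _ => integrable_finsetSum _ fun j _ => (hA i j).integrable_sq

lemma memLp_hardThreshold {A : Ω → Matrix (Fin J) (Fin J) ℝ} (s : ℝ) {i j : Fin J}
    (hA : MemLp (fun ω => A ω i j) 2 μ) : MemLp (fun ω => hardThreshold s (A ω) i j) 2 μ := by
  have hm : Measurable fun x : ℝ => if s ≤ |x| then x else 0 :=
    Measurable.ite (measurableSet_le measurable_const measurable_id.abs) measurable_id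
      measurable_const
  refine hA.mono (hm.comp_aemeasurable hA.aestronglyMeasurable.aemeasurable).aestronglyMeasurable
    (ae_of_all _ fun ω => ?_)
  simp only [hardThreshold]
  split_ifs <;> simp

variable {X : ℕ → Ω → Fin J → ℝ} {S : Matrix (Fin J) (Fin J) ℝ} {v : ℝ} {T B : ℕ}

variable [IsProbabilityMeasure μ]

lemma MomentConditions.integral_selectionGap_sq_le (h : MomentConditions μ X (T + B) S v) {M : ℝ}
    (hM : ∀ i, S i i ≤ M) (hT : 2 ≤ T) (hB : 1 ≤ B) {a r : ℝ} (har : a ≤ r)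
    (hr : ∫ ω, cvLoss X T B r ω ∂μ ≤ ∫ ω, cvLoss X T B a ω ∂μ) :
    Integrable (fun ω => selectionGap X S T B a r ω ^ 2) μ ∧
    ∫ ω, selectionGap X S T B a r ω ^ 2 ∂μ ≤
      (J : ℝ) ^ 2 * (432 * v * (2 * M + 3)) * ((B : ℝ)⁻¹ + (T : ℝ)⁻¹) := by
  have hL1 : ∀ i j, MemLp (fun ω => sampleCov X (Finset.range T) ω i j) 2 μ := fun i j =>
    h.memLp_sampleCov (fun t ht => by rw [Finset.mem_range] at ht; omega) i j
  have hL2 : ∀ i j, MemLp (fun ω => sampleCov X (Finset.Ico T (T + B)) ω i j) 2 μ := fun i j =>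
    h.memLp_sampleCov (fun t ht => by rw [Finset.mem_Ico] at ht; omega) i j
  have hN1 : Integrable (fun ω => ‖sampleCov X (Finset.range T) ω - S‖ ^ 2) μ :=
    integrable_frobenius_norm_sq fun i j => (hL1 i j).sub (memLp_const _)
  have hN2 : Integrable (fun ω => ‖sampleCov X (Finset.Ico T (T + B)) ω - S‖ ^ 2) μ :=
    integrable_frobenius_norm_sq fun i j => (hL2 i j).sub (memLp_const _)
  have hcv : ∀ s, Integrable (fun ω => cvLoss X T B s ω) μ := fun s =>
    integrable_frobenius_norm_sq fun i j => (memLp_hardThreshold s (hL1 i j)).sub (hL2 i j)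
  have hE1 := h.integral_norm_sampleCov_sub_sq_le hM (a := 0) (b := T) (by omega) (by omega)
    (by omega)
  have hE2 := h.integral_norm_sampleCov_sub_sq_le hM (a := T) (b := B) hB (by omega) le_rfl
  rw [zero_add, ← Finset.range_eq_Ico] at hE1
  have i1 := hN2.const_mul 36
  have i2 := hN1.const_mul 36
  have i3 := (hcv r).const_mul 6
  have i4 := (hcv a).const_mul 6
  have hint := ((i1.add i2).add i3).sub i4
  have hmeas : AEStronglyMeasurable (fun ω => selectionGap X S T B a r ω ^ 2) μ := by
    have hs : ∀ {A : Ω → Matrix (Fin J) (Fin J) ℝ}, Integrable (fun ω => ‖A ω‖ ^ 2) μ →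
        AEStronglyMeasurable (fun ω => ‖A ω‖) μ := fun hA => by
      simpa using (Real.continuous_sqrt.comp_aestronglyMeasurable hA.aestronglyMeasurable)
    have hD : Integrable (fun ω => ‖hardThreshold a (sampleCov X (Finset.range T) ω) -
        hardThreshold r (sampleCov X (Finset.range T) ω)‖ ^ 2) μ :=
      integrable_frobenius_norm_sq fun i j =>
        (memLp_hardThreshold a (hL1 i j)).sub (memLp_hardThreshold r (hL1 i j))
    exact ((((hs hN2).const_mul 2).add ((hs hN1).const_mul 2)).add (hs hD)).pow 2
  have hle := fun ω => selectionGap_sq_le X S T B har ω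
  refine ⟨hint.mono' hmeas (ae_of_all _ fun ω => ?_), ?_⟩
  · rw [Real.norm_of_nonneg (sq_nonneg _)]
    exact hle ω
  calc _ ≤ ∫ ω, (36 * ‖sampleCov X (Finset.Ico T (T + B)) ω - S‖ ^ 2 +
      36 * ‖sampleCov X (Finset.range T) ω - S‖ ^ 2 + 6 * cvLoss X T B r ω -
      6 * cvLoss X T B a ω) ∂μ :=
        integral_mono_of_nonneg (ae_of_all _ fun ω => sq_nonneg _) hint (ae_of_all _ hle)
    _ = 36 * ∫ ω, ‖sampleCov X (Finset.Ico T (T + B)) ω - S‖ ^ 2 ∂μ +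
      36 * ∫ ω, ‖sampleCov X (Finset.range T) ω - S‖ ^ 2 ∂μ + 6 * ∫ ω, cvLoss X T B r ω ∂μ -
      6 * ∫ ω, cvLoss X T B a ω ∂μ := by
        rw [integral_sub (by exact (i1.add i2).add i3) i4, integral_add (by exact i1.add i2) i3,
          integral_add i1 i2]
        simp only [integral_const_mul]
    _ ≤ 36 * ((J : ℝ) ^ 2 * (12 * v * (2 * M + 3) / B)) +
        36 * ((J : ℝ) ^ 2 * (12 * v * (2 * M + 3) / T)) := by linarith
    _ = _ := by ring

/-- The estimation errors of the empirical and of the oracle threshold differ by a fraction `η` of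
the latter with small probability, once the latter is of larger order than the sampling errors. -/
lemma MomentConditions.measure_abs_estError_sub_le (h : MomentConditions μ X (T + B) S v) {M : ℝ}
    (hM : ∀ i, S i i ≤ M) (hT : 2 ≤ T) (hB : 1 ≤ B) {G : Finset ℝ} {sHat : Ω → ℝ} {r : ℝ}
    (hsHat : ∀ ω, IsArgmin (fun s => cvLoss X T B s ω) G (sHat ω))
    (hr : IsArgmin (fun s => ∫ ω, cvLoss X T B s ω ∂μ) G r) {η R : ℝ} (hη : 0 < η) (hR : 0 < R) :
    μ {ω | η * |estError X T S r ω| < |estError X T S (sHat ω) ω - estError X T S r ω|} ≤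
      μ {ω | estError X T S r ω ^ 2 < R} +
      ENNReal.ofReal ((J : ℝ) ^ 2 * (432 * v * (2 * M + 3)) * ((B : ℝ)⁻¹ + (T : ℝ)⁻¹) /
        (η ^ 2 * R)) := by
  obtain ⟨a, ha, hmin⟩ := G.exists_minimal ⟨r, hr.1⟩
  have hle : ∀ s ∈ G, a ≤ s := fun s hs => (le_total a s).elim id fun hsa => hmin hs hsa
  obtain ⟨hint, hE⟩ := h.integral_selectionGap_sq_le hM hT hB (hle r hr.1) (hr.2 a ha)
  -- The right-hand side does not involve `sHat`, so no measurability of the selected threshold is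
  -- needed.
  have hgap : ∀ ω, |estError X T S (sHat ω) ω - estError X T S r ω| ≤
      selectionGap X S T B a r ω := fun ω =>
    abs_norm_hardThreshold_sub_le (hle _ (hsHat ω).1) ((hsHat ω).2 r hr.1)
  have hK : 0 < η ^ 2 * R := by positivity
  have hmarkov : μ {ω | η ^ 2 * R ≤ selectionGap X S T B a r ω ^ 2} ≤
      ENNReal.ofReal ((J : ℝ) ^ 2 * (432 * v * (2 * M + 3)) * ((B : ℝ)⁻¹ + (T : ℝ)⁻¹) /
        (η ^ 2 * R)) := by
    have := mul_meas_ge_le_integral_of_nonneg (ae_of_all _ fun ω => sq_nonneg _) hint (η ^ 2 * R)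
    rw [← ofReal_measureReal]
    refine ENNReal.ofReal_le_ofReal ?_
    rw [le_div_iff₀' hK]
    exact this.trans hE
  refine (measure_mono fun ω hω => ?_).trans ((measure_union_le _ _).trans
    (add_le_add_right hmarkov _))
  rcases lt_or_ge (estError X T S r ω ^ 2) R with hlt | hge
  · exact Or.inl hlt
  · refine Or.inr ?_
    have h1 : η * |estError X T S r ω| ≤ selectionGap X S T B a r ω :=
      (le_of_lt hω).trans (hgap ω)
    have h2 := pow_le_pow_left₀ (by positivity) h1 2
    rw [mul_pow, sq_abs] at h2
    exact le_trans (by gcongr) h2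

end CrossValidation

/-! ### Comparison with the exact rate and conclusion -/

lemma SparseClass.radius_nonneg {J : ℕ} {q c₀ M : ℝ} {A : Matrix (Fin J) (Fin J) ℝ}
    (h : SparseClass q c₀ M A) (hJ : 0 < J) : 0 ≤ c₀ := by
  refine (Finset.sum_nonneg fun j _ => ?_).trans (h ⟨0, hJ⟩).2
  split_ifs <;> positivity

/-- If two or more candidates satisfy the growth condition, then the sampling error `J² / B` is of
smaller order than the exact rate. -/
lemma sq_div_le_rate {J T B c₀ L q e κ : ℝ} (hJ : 0 < J) (hT : 0 < T) (hL : 0 ≤ L) (he : 0 < e)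
    (hB : B = T * e) {l : ℝ}
    (h : l ≤ κ * (T ^ (q / 2) * c₀ * J⁻¹ * L ^ (1 - q / 2) * e)) :
    l * (J ^ 2 / B) ≤ κ * (J * (c₀ * (L / T) ^ (1 - q / 2))) := by
  have hT' : T ^ (q / 2) * T ^ (1 - q / 2) = T := by
    rw [← Real.rpow_add hT]; simp
  have hpos : 0 < T ^ (1 - q / 2) := Real.rpow_pos_of_pos hT _
  have hpos' : 0 < T ^ (q / 2) := Real.rpow_pos_of_pos hT _
  calc l * (J ^ 2 / B) ≤ κ * (T ^ (q / 2) * c₀ * J⁻¹ * L ^ (1 - q / 2) * e) * (J ^ 2 / B) := by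
        have : 0 < B := hB ▸ mul_pos hT he
        gcongr
    _ = κ * (J * (c₀ * (L / T) ^ (1 - q / 2))) := by
        rw [Real.div_rpow hL hT.le, hB]
        nth_rw 2 [← hT']
        field_simp

theorem theorem3 {Ω : ℕ → Type*} [∀ n, MeasurableSpace (Ω n)]
    (μ : ∀ n, Measure (Ω n)) [∀ n, IsProbabilityMeasure (μ n)]
    -- training sample size, validation sample size and dimension along the asymptotics
    (T B J : ℕ → ℕ) (hT : Tendsto T atTop atTop)
    (X : ∀ n, ℕ → Ω n → Fin (J n) → ℝ)
    (S : ∀ n, Matrix (Fin (J n)) (Fin (J n)) ℝ)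
    -- the sparsity class
    (q M : ℝ) (c₀ : ℕ → ℝ) (hq0 : 0 ≤ q) (hq1 : q < 1)
    (hS : ∀ n, SparseClass q (c₀ (J n)) M (S n))
    -- moment conditions, and boundedness with high probability
    (σsq : ℝ) (hX : ∀ n, MomentConditions (μ n) (X n) (T n + B n) (S n) σsq)
    (hbdd : Tendsto (fun n => μ n {ω | ∃ t < T n + B n, ∃ i j, M < |X n t ω i * X n t ω j|})
      atTop (𝓝 0))
    -- mixing of the product sequences, at a lag of smaller order than the sample size
    (δ Cβ : ℝ) (hδ : 0 < δ) (lag : ℕ → ℕ) (hlag1 : ∀ n, 1 ≤ lag n)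
    (hlag : (fun n => (lag n : ℝ)) =o[atTop] fun n => (T n : ℝ))
    (hmix : ∀ᶠ n in atTop, ∀ i j,
      betaMix (μ n) (fun t ω => X n t ω i * X n t ω j) (T n + B n) (lag n) ≤
        ENNReal.ofReal (Cβ / ((J n : ℝ) ^ (2 + δ) * √(Real.log (J n) * T n))))
    (hJT : Tendsto (fun n => Real.log (J n) / T n) atTop (𝓝 0))
    -- the size of the validation sample
    (ε : ℕ → ℕ → ℝ) (Cε : ℝ) (hε : ∀ n, 0 < ε (T n) (J n) ∧ ε (T n) (J n) ≤ Cε)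
    (hB : ∀ n, (B n : ℝ) = T n * ε (T n) (J n))
    -- the candidate thresholds
    (G : ℕ → Finset ℝ)
    (hP : (fun n => Real.log (G n).card) =o[atTop] fun n =>
      (T n : ℝ) ^ (q / 2) * c₀ (J n) * (J n : ℝ)⁻¹ * Real.log (J n) ^ (1 - q / 2) *
        ε (T n) (J n))
    -- the empirical and the oracle threshold
    (sHat : ∀ n, Ω n → ℝ) (sOracle : ℕ → ℝ)
    (hsHat : ∀ n ω, IsArgmin (fun s => cvLoss (X n) (T n) (B n) s ω) (G n) (sHat n ω))
    (hsOracle : ∀ n,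
      IsArgmin (fun s => ∫ ω, cvLoss (X n) (T n) (B n) s ω ∂(μ n)) (G n) (sOracle n))
    -- the rate of convergence is exact for the oracle
    (hΩ : IsOmegaP μ (fun n ω => (J n : ℝ)⁻¹ * estError (X n) (T n) (S n) (sOracle n) ω ^ 2)
      (fun n => c₀ (J n) * (Real.log (J n) / T n) ^ (1 - q / 2))) :
    EqOneAddLittleOP μ
      (fun n ω => estError (X n) (T n) (S n) (sHat n ω) ω)
      (fun n ω => estError (X n) (T n) (S n) (sOracle n) ω) := by
  intro η hη
  rw [ENNReal.tendsto_nhds_zero]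
  intro e' he'
  obtain ⟨e, he, hee'⟩ : ∃ e : ℝ, 0 < e ∧ ENNReal.ofReal e + ENNReal.ofReal e ≤ e' := by
    obtain ⟨x, hx0, hx⟩ := ENNReal.lt_iff_exists_real_btwn.1 he'
    have hx1 : 0 < x := ENNReal.ofReal_pos.1 hx.1
    refine ⟨x / 2, by positivity, ?_⟩
    rw [← ENNReal.ofReal_add (by positivity) (by positivity), add_halves]
    exact hx.2.le
  obtain ⟨c, hc, hcΩ⟩ := hΩ e he
  set C : ℝ := |432 * σsq * (2 * M + 3)| * (1 + Cε) with hC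
  have hCε : 0 < Cε := (hε 0).1.trans_le (hε 0).2
  have hC0 : 0 ≤ C := by positivity
  have hlog2 : 0 < Real.log 2 := Real.log_pos one_lt_two
  -- Chosen so that the Markov bound is at most `e`; `C + 1` avoids dividing by zero.
  set κ : ℝ := e * η ^ 2 * c * Real.log 2 / (C + 1) with hκ
  have hκ0 : 0 < κ := by positivity
  filter_upwards [hcΩ, hP.bound hκ0, hT.eventually_ge_atTop 2] with n hΩn hPn hTn
  rcases Nat.lt_or_ge (G n).card 2 with hcard | hcard
  · have heq : ∀ ω, sHat n ω = sOracle n := fun ω =>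
      Finset.card_le_one.1 (by omega) _ (hsHat n ω).1 _ (hsOracle n).1
    have hempty : {ω | η * |estError (X n) (T n) (S n) (sOracle n) ω| <
        |estError (X n) (T n) (S n) (sHat n ω) ω - estError (X n) (T n) (S n) (sOracle n) ω|} =
        ∅ := by
      ext ω
      simp only [heq, sub_self, abs_zero, Set.mem_ofPred_eq, Set.mem_empty_iff_false, iff_false,
        not_lt]
      positivity
    rw [hempty, measure_empty]
    exact zero_le
  have hT0 : (0 : ℝ) < T n := by exact_mod_cast (by omega : 0 < T n)
  have hε0 := (hε n).1
  have hB0 : (0 : ℝ) < B n := by rw [hB n]; positivity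
  have hlogP : Real.log 2 ≤ ‖Real.log (G n).card‖ :=
    (Real.log_le_log two_pos (by exact_mod_cast hcard)).trans (le_abs_self _)
  -- For `J n = 0`, the convention `0⁻¹ = 0` turns the growth bound into `log 2 ≤ 0`.
  have hJ : 0 < J n := by
    by_contra hJ0
    obtain hJ0 : J n = 0 := by omega
    rw [hJ0] at hPn
    simp only [Nat.cast_zero, inv_zero, mul_zero, zero_mul, norm_zero] at hPn
    linarith
  have hJ0 : (0 : ℝ) < J n := by exact_mod_cast hJ
  have hL : 0 ≤ Real.log (J n) := Real.log_natCast_nonneg _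
  have hc₀ : 0 ≤ c₀ (J n) := (hS n).radius_nonneg hJ
  have hrate := sq_div_le_rate hJ0 hT0 hL hε0 (hB n) (q := q) (c₀ := c₀ (J n)) (κ := κ)
    (l := Real.log 2) (by
      refine hlogP.trans (hPn.trans_eq ?_)
      rw [Real.norm_of_nonneg (by positivity)])
  set R : ℝ := J n * (c₀ (J n) * (Real.log (J n) / T n) ^ (1 - q / 2)) with hRdef
  have hR0 : 0 < R := by
    have : 0 < κ * R := lt_of_lt_of_le (by positivity) hrate
    exact (mul_pos_iff_of_pos_left hκ0).1 this
  refine ((hX n).measure_abs_estError_sub_le (fun i => (hS n i).1) hTn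
    (by exact_mod_cast hB0) (hsHat n) (hsOracle n) hη (mul_pos hc hR0)).trans
    ((add_le_add ?_ (ENNReal.ofReal_le_ofReal ?_)).trans hee')
  · refine (measure_mono fun ω hω => ?_).trans hΩn
    simp only [Set.mem_ofPred_eq] at hω ⊢
    rw [inv_mul_lt_iff₀ hJ0]
    calc _ < _ := hω
      _ = _ := by rw [hRdef]; ring
  · rw [div_le_iff₀ (by positivity)]
    have hTB : (B n : ℝ)⁻¹ + (T n : ℝ)⁻¹ ≤ (1 + Cε) * (B n : ℝ)⁻¹ := by
      have : (T n : ℝ)⁻¹ = ε (T n) (J n) * (B n : ℝ)⁻¹ := by rw [hB n]; field_simp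
      rw [this, add_mul, one_mul]
      gcongr
      exact (hε n).2
    calc (J n : ℝ) ^ 2 * (432 * σsq * (2 * M + 3)) * ((B n : ℝ)⁻¹ + (T n : ℝ)⁻¹)
        ≤ (J n : ℝ) ^ 2 * |432 * σsq * (2 * M + 3)| * ((1 + Cε) * (B n : ℝ)⁻¹) := by
          gcongr
          exact le_abs_self _
      _ = C / Real.log 2 * (Real.log 2 * ((J n : ℝ) ^ 2 / B n)) := by
          rw [hC]; field_simp
      _ ≤ C / Real.log 2 * (κ * R) := by gcongr
      _ = C / (C + 1) * (e * (η ^ 2 * (c * R))) := by rw [hκ]; field_simp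
      _ ≤ 1 * (e * (η ^ 2 * (c * R))) := by
          gcongr
          rw [div_le_one (by positivity)]
          linarith
      _ = e * (η ^ 2 * (c * R)) := one_mul _
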